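/- A cell is a unit square of the square lattice, and a polyomino is a nonempty finite edge-connected set of cells, considered up to translation; its area is its number of cells. A polyomino $P$ is directed if it has a cell, called its origin, from which every cell of $P$ can be reached by a path of north and east unit steps inside $P$; the origin is then the bottom left-hand corner cell. $P$ is column-convex if the cells of each column of $P$ are consecutive. The internal path length of a cell $c$ of a directed column-convex polyomino $P$ is the least number of cells (the origin and $c$ included) on a path inside $P$ from the origin to $c$ that moves between edge-adjacent cells; thus the origin has internal path length $1$. The total internal path length of $P$ is the sum of the internal path lengths of its cells. For an integer $d\ge 0$, a directed column-convex polyomino whose columns have, from left to right, lowest cells at heights $a_1,a_2,\dots,a_k$ is $d$-restricted if $a_{i+1}-a_i\ge d$ for all $2\le i\le k-1$. Let $t_d(n)$ be the sum of the total internal path lengths of all $d$-restricted directed column-convex polyominoes of area $n$, and let $T_d(x)=\sum_{n\ge 0}t_d(n)x^n$. **Corollary.** The generating function, by area, of the total internal path length of all directed column-convex polyominoes is $T_0(x)$, and, as formal power series, $$T_0(x)=\frac{x\left(3x^4-9x^3+8x^2-4x+1\right)}{(1-x)\left(x^2-3x+1\right)^3}.$$ -/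

import Mathlib

namespace Polyomino

/-- The adjacency graph of a finite set `P` of unit cells of the square lattice (a cell is named by
the coordinates of its lower left corner): two cells of `P` are adjacent when they share an edge. -/
def cellGraph (P : Finset (ℤ × ℤ)) : SimpleGraph (ℤ × ℤ) where
  Adj c c' := c ∈ P ∧ c' ∈ P ∧ |c.1 - c'.1| + |c.2 - c'.2| = 1
  symm := ⟨fun c c' h => ⟨h.2.1, h.1, by
    rw [abs_sub_comm c'.1, abs_sub_comm c'.2]; exact h.2.2⟩⟩
  loopless := ⟨fun c h => by simp at h⟩

/-- A polyomino: a nonempty finite edge-connected set of cells. -/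
def IsPolyomino (P : Finset (ℤ × ℤ)) : Prop :=
  P.Nonempty ∧ ∀ c ∈ P, ∀ c' ∈ P, (cellGraph P).Reachable c c'

/-- A north step or an east step between two cells of `P`. -/
def NEStep (P : Finset (ℤ × ℤ)) (c c' : ℤ × ℤ) : Prop :=
  c ∈ P ∧ c' ∈ P ∧ (c' = (c.1, c.2 + 1) ∨ c' = (c.1 + 1, c.2))

/-- `P` is directed, with the cell `(0, 0)` as its bottom left-hand corner cell: every cell of `P`
can be reached from it by north and east steps inside `P`. -/
def IsDirected (P : Finset (ℤ × ℤ)) : Prop :=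
  (0, 0) ∈ P ∧ ∀ c ∈ P, Relation.ReflTransGen (NEStep P) (0, 0) c

/-- Every column of `P` is a contiguous vertical strip. -/
def IsColumnConvex (P : Finset (ℤ × ℤ)) : Prop :=
  ∀ i y₁ y y₂ : ℤ, (i, y₁) ∈ P → (i, y₂) ∈ P → y₁ ≤ y → y ≤ y₂ → (i, y) ∈ P

/-- Directed column-convex polyominoes. Polyominoes are considered up to translation; each
translation class is represented by its member with origin `(0, 0)`. -/
def IsDccp (P : Finset (ℤ × ℤ)) : Prop :=
  IsPolyomino P ∧ IsDirected P ∧ IsColumnConvex P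

/-- `a` is the initial altitude (the height of the lowest cell) of the column of `P` with
abscissa `i`. -/
def IsInitialAltitude (P : Finset (ℤ × ℤ)) (i a : ℤ) : Prop :=
  (i, a) ∈ P ∧ ∀ y, (i, y) ∈ P → a ≤ y

/-- `P` is `d`-restricted: the initial altitude grows by at least `d` from each column to the next,
the first column (the one with abscissa `0`) excepted. This holds trivially if there are at most
two columns. -/
def IsRestricted (d : ℕ) (P : Finset (ℤ × ℤ)) : Prop :=
  ∀ i a a' : ℤ, 1 ≤ i → IsInitialAltitude P i a → IsInitialAltitude P (i + 1) a' →
    (d : ℤ) ≤ a' - a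

/-- The internal path length of a cell: the least number of steps that lead to it through `P` by way
of adjacent cells, where entering the origin `(0, 0)` counts as the first step. -/
noncomputable def ipl (P : Finset (ℤ × ℤ)) (c : ℤ × ℤ) : ℕ :=
  (cellGraph P).dist (0, 0) c + 1

/-- The total internal path length. -/
noncomputable def tipl (P : Finset (ℤ × ℤ)) : ℕ :=
  ∑ c ∈ P, ipl P c

theorem IsDirected.bounds {P : Finset (ℤ × ℤ)} {c : ℤ × ℤ} (h0 : (0, 0) ∈ P)
    (h : Relation.ReflTransGen (NEStep P) (0, 0) c) :
    0 ≤ c.1 ∧ 0 ≤ c.2 ∧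
      Finset.Icc 0 (c.1 + c.2) ⊆ P.image (fun e : ℤ × ℤ => e.1 + e.2) := by
  induction h with
  | refl =>
    refine ⟨le_rfl, le_rfl, fun k hk => ?_⟩
    rw [Finset.mem_Icc] at hk
    exact Finset.mem_image.2 ⟨(0, 0), h0, by simp only at hk ⊢; omega⟩
  | @tail b c _ hbc ih =>
    obtain ⟨h1, h2, h3⟩ := ih
    obtain ⟨_, hc, hs⟩ := hbc
    have hsum : c.1 + c.2 = b.1 + b.2 + 1 ∧ 0 ≤ c.1 ∧ 0 ≤ c.2 := by
      rcases hs with rfl | rfl <;> refine ⟨?_, ?_, ?_⟩ <;> simp only <;> omega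
    refine ⟨hsum.2.1, hsum.2.2, fun k hk => ?_⟩
    rw [Finset.mem_Icc] at hk
    by_cases hk' : k ≤ b.1 + b.2
    · exact h3 (Finset.mem_Icc.2 ⟨hk.1, hk'⟩)
    · exact Finset.mem_image.2 ⟨c, hc, by omega⟩

theorem finite_dccp (n : ℕ) : {P : Finset (ℤ × ℤ) | IsDccp P ∧ P.card = n}.Finite := by
  refine Set.Finite.subset
    (Finset.finite_toSet (Finset.Icc (0 : ℤ) n ×ˢ Finset.Icc (0 : ℤ) n).powerset) ?_
  rintro P ⟨⟨_, ⟨h0, hP⟩, _⟩, hn⟩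
  rw [Finset.mem_coe, Finset.mem_powerset]
  intro c hc
  obtain ⟨h1, h2, h3⟩ := IsDirected.bounds h0 (hP c hc)
  have h4 := (Finset.card_le_card h3).trans Finset.card_image_le
  rw [Int.card_Icc, hn] at h4
  rw [Finset.mem_product, Finset.mem_Icc, Finset.mem_Icc]
  omega

/-- All directed column-convex polyominoes of area `n`. -/
noncomputable def dccps (n : ℕ) : Finset (Finset (ℤ × ℤ)) :=
  (finite_dccp n).toFinset

open scoped Classical in
/-- `t_d(n)`: the sum of the total internal path lengths of all `d`-restricted directed
column-convex polyominoes of area `n`. -/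
noncomputable def restrictedTipl (d n : ℕ) : ℕ :=
  ∑ P ∈ dccps n with IsRestricted d P, tipl P

/-- The generating function `T_d(x) = ∑ t_d(n) x ^ n`. -/
noncomputable def restrictedTiplSeries (d : ℕ) : PowerSeries ℚ :=
  PowerSeries.mk fun n => (restrictedTipl d n : ℚ)

/-- The generating function, by area, of the total internal path length of all directed
column-convex polyominoes. -/
noncomputable def dccpTiplSeries : PowerSeries ℚ :=
  PowerSeries.mk fun n => ((∑ P ∈ dccps n, tipl P : ℕ) : ℚ)

end Polyomino

/-!
North and east steps both raise `x + y` by one, so in a directed polyomino the cell `(x, y)` has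
internal path length `x + y + 1`. Removing the first column, of `h` cells say, from a directed
column-convex polyomino leaves nothing, or a directed column-convex polyomino `Q` whose origin is
attached to one of these `h` cells, say the one at height `j`; conversely every choice of `h`,
`j < h` and `Q` occurs exactly once. The cells of `Q` take `j + 1` more steps to reach. Summing over
`j`, the generating functions `F` of the number of polyominoes and `T` of the total internal path
length satisfy, with `G = 1 / (1 - X)`,
`F = X * (G + G ^ 2 * F)` and
`T = X * (G ^ 3 + (3 * G ^ 4 - 2 * G ^ 3) * F + G ^ 2 * T + G ^ 3 * (X * F'))`,
which determine both.
-/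

namespace Polyomino

section Geometry

variable {P Q Q' : Finset (ℤ × ℤ)} {h j h' j' : ℕ}

/-! ### Directed polyominoes and internal path lengths -/

theorem NEStep.adj {a b : ℤ × ℤ} (hab : NEStep P a b) : (cellGraph P).Adj a b := by
  obtain ⟨ha, hb, rfl | rfl⟩ := hab <;> exact ⟨ha, hb, by simp⟩

theorem exists_walk_length_eq_of_reflTransGen {a b : ℤ × ℤ}
    (hab : Relation.ReflTransGen (NEStep P) a b) :
    ∃ w : (cellGraph P).Walk a b, (w.length : ℤ) = b.1 + b.2 - (a.1 + a.2) := by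
  induction hab with
  | refl => exact ⟨.nil, by simp⟩
  | tail _ hbc ih =>
    obtain ⟨w, hw⟩ := ih
    refine ⟨w.concat hbc.adj, ?_⟩
    rw [SimpleGraph.Walk.length_concat]
    obtain ⟨_, _, rfl | rfl⟩ := hbc <;> push_cast <;> omega

theorem sub_le_walk_length {a b : ℤ × ℤ} (w : (cellGraph P).Walk a b) :
    b.1 + b.2 - (a.1 + a.2) ≤ w.length := by
  induction w with
  | nil => simp
  | @cons a c _ hac _ ih =>
    rw [SimpleGraph.Walk.length_cons]
    have hx := neg_abs_le (a.1 - c.1)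
    have hy := neg_abs_le (a.2 - c.2)
    have hdist := hac.2.2
    push_cast
    omega

theorem dist_eq_of_reflTransGen {a b : ℤ × ℤ} (hab : Relation.ReflTransGen (NEStep P) a b) :
    ((cellGraph P).dist a b : ℤ) = b.1 + b.2 - (a.1 + a.2) := by
  obtain ⟨w, hw⟩ := exists_walk_length_eq_of_reflTransGen hab
  obtain ⟨w', hw'⟩ := w.reachable.exists_walk_length_eq_dist
  apply le_antisymm
  · exact_mod_cast hw ▸ Nat.cast_le.2 (SimpleGraph.dist_le w)
  · exact hw' ▸ sub_le_walk_length w'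

theorem IsDirected.ipl_eq (hP : IsDirected P) {c : ℤ × ℤ} (hc : c ∈ P) :
    (ipl P c : ℤ) = c.1 + c.2 + 1 := by
  rw [ipl, Nat.cast_add, dist_eq_of_reflTransGen (hP.2 c hc)]
  simp

theorem IsDirected.isPolyomino (hP : IsDirected P) : IsPolyomino P := by
  have reachable_origin : ∀ c ∈ P, (cellGraph P).Reachable (0, 0) c := fun c hc =>
    (exists_walk_length_eq_of_reflTransGen (hP.2 c hc)).choose.reachable
  exact ⟨⟨_, hP.1⟩, fun c hc c' hc' =>
    (reachable_origin c hc).symm.trans (reachable_origin c' hc')⟩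

theorem isDccp_iff : IsDccp P ↔ IsDirected P ∧ IsColumnConvex P :=
  ⟨And.right, fun hP => ⟨hP.1.isPolyomino, hP⟩⟩

theorem IsDccp.isDirected (hP : IsDccp P) : IsDirected P := hP.2.1

theorem IsDccp.isColumnConvex (hP : IsDccp P) : IsColumnConvex P := hP.2.2

theorem IsDirected.nonneg (hP : IsDirected P) {x y : ℤ} (hc : (x, y) ∈ P) : 0 ≤ x ∧ 0 ≤ y :=
  (IsDirected.bounds hP.1 (hP.2 _ hc)).imp_right And.left

theorem IsDirected.west_mem_or_south_mem (hP : IsDirected P) {x y : ℤ} (hc : (x, y) ∈ P) :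
    (x = 0 ∧ y = 0) ∨ (x - 1, y) ∈ P ∨ (x, y - 1) ∈ P := by
  rcases (hP.2 _ hc).cases_tail with h_eq | ⟨⟨u, v⟩, _, hb, _, hs⟩
  · exact .inl (by simpa using h_eq)
  · simp only [Prod.mk.injEq] at hs
    rcases hs with ⟨rfl, rfl⟩ | ⟨rfl, rfl⟩
    · exact .inr (.inr (by simpa using hb))
    · exact .inr (.inl (by simpa using hb))

theorem isDirected_of_west_mem_or_south_mem (h_origin : (0, 0) ∈ P)
    (h_nonneg : ∀ x y, (x, y) ∈ P → 0 ≤ x ∧ 0 ≤ y)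
    (h_pred : ∀ x y, (x, y) ∈ P → (x = 0 ∧ y = 0) ∨ (x - 1, y) ∈ P ∨ (x, y - 1) ∈ P) :
    IsDirected P := by
  have reach (n : ℕ) : ∀ x y : ℤ, (x, y) ∈ P → x + y = n →
      Relation.ReflTransGen (NEStep P) (0, 0) (x, y) := by
    induction n with
    | zero =>
      intro x y hc hn
      have := h_nonneg x y hc
      obtain ⟨rfl, rfl⟩ : x = 0 ∧ y = 0 := by omega
      exact .refl
    | succ n ih =>
      intro x y hc hn
      rcases h_pred x y hc with h0 | h_west | h_south
      · omega
      · exact (ih _ _ h_west (by omega)).tail ⟨h_west, hc, .inr (by simp)⟩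
      · exact (ih _ _ h_south (by omega)).tail ⟨h_south, hc, .inl (by simp)⟩
  refine ⟨h_origin, fun ⟨x, y⟩ hc => reach (x + y).toNat x y hc ?_⟩
  have := h_nonneg x y hc
  omega

theorem IsDirected.isRestricted_zero (hP : IsDirected P) : IsRestricted 0 P := by
  intro i a a' hi ha ha'
  rw [Nat.cast_zero, sub_nonneg]
  rcases hP.west_mem_or_south_mem ha'.1 with h_origin | h_west | h_south
  · omega
  · exact ha.2 a' (by simpa using h_west)
  · have := ha'.2 _ h_south
    omega

theorem mem_dccps {n : ℕ} : P ∈ dccps n ↔ IsDccp P ∧ P.card = n := by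
  rw [dccps, Set.Finite.mem_toFinset, Set.mem_ofPred_eq]

theorem dccps_zero : dccps 0 = ∅ := by
  refine Finset.eq_empty_of_forall_notMem fun P hP => ?_
  obtain ⟨hP, h_card⟩ := mem_dccps.1 hP
  exact (Finset.card_pos.2 hP.1.1).ne' h_card

/-! ### Splitting off the first column -/

/-- The single column of `h` cells standing on the origin. -/
def column (h : ℕ) : Finset (ℤ × ℤ) :=
  {0} ×ˢ (Finset.range h).map Nat.castEmbedding

/-- The set obtained by attaching `Q`, translated so that its origin lies at `(1, j)`, to the right
of a column of `h` cells. -/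
def glue (h j : ℕ) (Q : Finset (ℤ × ℤ)) : Finset (ℤ × ℤ) :=
  column h ∪ Q.map (addRightEmbedding ((1 : ℤ), (j : ℤ)))

/-- What remains of `P` to the right of its first column, translated so that `(1, j)` becomes the
origin: the inverse operation to `glue`. -/
def removeColumn (j : ℕ) (P : Finset (ℤ × ℤ)) : Finset (ℤ × ℤ) :=
  {c ∈ P | 1 ≤ c.1}.map (addRightEmbedding ((-1 : ℤ), -(j : ℤ)))

theorem mem_column {x y : ℤ} : (x, y) ∈ column h ↔ x = 0 ∧ 0 ≤ y ∧ y < h := by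
  simp only [column, Finset.mem_product, Finset.mem_singleton, Finset.mem_map, Finset.mem_range,
    Nat.castEmbedding_apply]
  refine and_congr_right fun _ => ⟨?_, fun hy => ⟨y.toNat, by omega, by omega⟩⟩
  rintro ⟨k, hk, rfl⟩
  omega

theorem mem_map_addRightEmbedding {a b x y : ℤ} :
    (x, y) ∈ Q.map (addRightEmbedding (a, b)) ↔ (x - a, y - b) ∈ Q := by
  rw [Finset.mem_map]
  constructor
  · rintro ⟨c, hc, hxy⟩
    obtain ⟨rfl, rfl⟩ := Prod.mk.inj hxy
    simpa using hc
  · exact fun hc => ⟨_, hc, by simp⟩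

theorem mem_glue {x y : ℤ} :
    (x, y) ∈ glue h j Q ↔ (x = 0 ∧ 0 ≤ y ∧ y < h) ∨ (x - 1, y - j) ∈ Q := by
  rw [glue, Finset.mem_union, mem_column, mem_map_addRightEmbedding]

theorem mem_removeColumn {x y : ℤ} :
    (x, y) ∈ removeColumn j P ↔ 0 ≤ x ∧ (x + 1, y + j) ∈ P := by
  rw [removeColumn, mem_map_addRightEmbedding, Finset.mem_filter, sub_neg_eq_add, sub_neg_eq_add,
    and_comm]
  exact and_congr_left fun _ => by simp

theorem card_column (h : ℕ) : (column h).card = h := by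
  simp [column]

theorem isDccp_column (hh : 0 < h) : IsDccp (column h) := by
  refine isDccp_iff.2 ⟨isDirected_of_west_mem_or_south_mem ?_ (fun x y => ?_) (fun x y => ?_),
    fun x y₁ y y₂ => ?_⟩
  · exact mem_column.2 (by omega)
  all_goals
    simp only [mem_column]
    omega

theorem IsDirected.disjoint_column (hQ : IsDirected Q) (h j : ℕ) :
    Disjoint (column h) (Q.map (addRightEmbedding ((1 : ℤ), (j : ℤ)))) := by
  rw [Finset.disjoint_left]
  rintro ⟨x, y⟩ hc hc'
  rw [mem_column] at hc
  have := hQ.nonneg (mem_map_addRightEmbedding.1 hc')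
  omega

theorem IsDirected.card_glue (hQ : IsDirected Q) (h j : ℕ) :
    (glue h j Q).card = h + Q.card := by
  rw [glue, Finset.card_union_of_disjoint (hQ.disjoint_column h j), card_column, Finset.card_map]

theorem isDirected_glue (hQ : IsDirected Q) (hj : j < h) : IsDirected (glue h j Q) := by
  apply isDirected_of_west_mem_or_south_mem
  · exact mem_glue.2 (by omega)
  · intro x y hc
    rcases mem_glue.1 hc with hc | hc
    · omega
    · have := hQ.nonneg hc
      omega
  · intro x y hc
    simp only [mem_glue] at hc ⊢
    rcases hc with hc | hc
    · omega
    · rcases hQ.west_mem_or_south_mem hc with h_origin | h_west | h_south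
      · omega
      · exact .inr (.inl (.inr h_west))
      · exact .inr (.inr (.inr (sub_right_comm y j 1 ▸ h_south)))

theorem isDccp_glue (hQ : IsDccp Q) (hj : j < h) : IsDccp (glue h j Q) := by
  refine isDccp_iff.2 ⟨isDirected_glue hQ.isDirected hj, fun x y₁ y y₂ h₁ h₂ hy₁ hy₂ => ?_⟩
  rw [mem_glue] at h₁ h₂ ⊢
  rcases h₁ with h₁ | h₁ <;> rcases h₂ with h₂ | h₂
  · omega
  · have := hQ.isDirected.nonneg h₂
    omega
  · have := hQ.isDirected.nonneg h₁
    omega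
  · exact .inr (hQ.isColumnConvex _ _ _ _ h₁ h₂ (by omega) (by omega))

theorem origin_mem_glue (hQ : IsDirected Q) (h j : ℕ) : ((1 : ℤ), (j : ℤ)) ∈ glue h j Q :=
  mem_glue.2 (.inr (by simpa using hQ.1))

theorem glue_ne_column (hQ : IsDirected Q) (h j n : ℕ) : glue h j Q ≠ column n := by
  intro h_eq
  have h_mem := origin_mem_glue hQ h j
  rw [h_eq, mem_column] at h_mem
  omega

theorem removeColumn_glue (hQ : IsDirected Q) (h j : ℕ) : removeColumn j (glue h j Q) = Q := by
  ext ⟨x, y⟩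
  rw [mem_removeColumn, mem_glue, add_sub_cancel_right, add_sub_cancel_right]
  constructor
  · rintro ⟨hx, hc | hc⟩
    · omega
    · exact hc
  · exact fun hc => ⟨(hQ.nonneg hc).1, .inr hc⟩

theorem height_le_of_glue_eq (hQ' : IsDirected Q') (h_eq : glue h j Q = glue h' j' Q') :
    h ≤ h' := by
  by_contra! h_lt
  have h_mem : ((0 : ℤ), (h' : ℤ)) ∈ glue h j Q := mem_glue.2 (by omega)
  rcases mem_glue.1 (h_eq ▸ h_mem) with hc | hc
  · omega
  · have := hQ'.nonneg hc
    omega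

theorem altitude_le_of_glue_eq (hQ : IsDirected Q) (hQ' : IsDirected Q')
    (h_eq : glue h j Q = glue h' j' Q') : j' ≤ j := by
  rcases mem_glue.1 (h_eq ▸ origin_mem_glue hQ h j) with hc | hc
  · omega
  · have := hQ'.nonneg hc
    omega

theorem glue_inj (hQ : IsDirected Q) (hQ' : IsDirected Q')
    (h_eq : glue h j Q = glue h' j' Q') : h = h' ∧ j = j' ∧ Q = Q' := by
  obtain rfl : h = h' :=
    (height_le_of_glue_eq hQ' h_eq).antisymm (height_le_of_glue_eq hQ h_eq.symm)
  obtain rfl : j = j' :=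
    (altitude_le_of_glue_eq hQ' hQ h_eq.symm).antisymm (altitude_le_of_glue_eq hQ hQ' h_eq)
  exact ⟨rfl, rfl, by rw [← removeColumn_glue hQ h j, h_eq, removeColumn_glue hQ']⟩

theorem IsDccp.exists_height (hP : IsDccp P) :
    ∃ h : ℕ, ∀ y : ℤ, (0, y) ∈ P ↔ 0 ≤ y ∧ y < h := by
  have exists_notMem : ∃ k : ℕ, ((0 : ℤ), (k : ℤ)) ∉ P := by
    obtain ⟨k, hk⟩ := Infinite.exists_notMem_finset
      (P.preimage (fun k : ℕ => ((0 : ℤ), (k : ℤ))) fun a _ b _ hab => by simpa using hab)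
    exact ⟨k, fun h_mem => hk (Finset.mem_preimage.2 h_mem)⟩
  refine ⟨Nat.find exists_notMem, fun y => ⟨fun hy => ?_, fun hy => ?_⟩⟩
  · have h_nonneg := (hP.isDirected.nonneg hy).2
    refine ⟨h_nonneg, lt_of_not_ge fun h_le => Nat.find_spec exists_notMem ?_⟩
    exact hP.isColumnConvex 0 0 _ y hP.isDirected.1 hy (by omega) h_le
  · lift y to ℕ using hy.1
    exact not_not.1 (Nat.find_min exists_notMem (by omega))

/-- The north and east steps that lead to `c` leave the first column exactly once, by an east step,
and never descend afterwards. -/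
theorem IsDirected.exists_east_step_le (hP : IsDirected P) {c : ℤ × ℤ} (hc : c ∈ P)
    (hc1 : 1 ≤ c.1) : ∃ y ≤ c.2, (0, y) ∈ P ∧ (1, y) ∈ P := by
  have h_path := hP.2 c hc
  clear hc
  induction h_path with
  | refl => simp at hc1
  | @tail b c _ hbc ih =>
    obtain ⟨hb, hc, hs⟩ := hbc
    by_cases hb1 : 1 ≤ b.1
    · obtain ⟨y, hy, hy01⟩ := ih hb1
      refine ⟨y, hy.trans ?_, hy01⟩
      rcases hs with rfl | rfl <;> simp
    · have hb0 : b.1 = 0 := by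
        have := hP.nonneg hb
        omega
      rcases hs with rfl | rfl
      · exact absurd hc1 hb1
      · refine ⟨b.2, le_rfl, ?_, ?_⟩
        · rwa [← hb0]
        · simpa [hb0] using hc

theorem IsDirected.exists_altitude (hP : IsDirected P) (hP1 : ∃ c ∈ P, 1 ≤ c.1) :
    ∃ j : ℕ, (0, (j : ℤ)) ∈ P ∧ (1, (j : ℤ)) ∈ P ∧ ∀ c ∈ P, 1 ≤ c.1 → j ≤ c.2 := by
  have exists_east_step_le_nat : ∀ c ∈ P, 1 ≤ c.1 →
      ∃ k : ℕ, (k : ℤ) ≤ c.2 ∧ (0, (k : ℤ)) ∈ P ∧ (1, (k : ℤ)) ∈ P := by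
    intro c hc hc1
    obtain ⟨y, hy, hy0, hy1⟩ := hP.exists_east_step_le hc hc1
    lift y to ℕ using (hP.nonneg hy0).2
    exact ⟨y, hy, hy0, hy1⟩
  have exists_east_step : ∃ k : ℕ, (0, (k : ℤ)) ∈ P ∧ (1, (k : ℤ)) ∈ P := by
    obtain ⟨c, hc, hc1⟩ := hP1
    exact (exists_east_step_le_nat c hc hc1).imp fun _ => And.right
  refine ⟨Nat.find exists_east_step, (Nat.find_spec exists_east_step).1,
    (Nat.find_spec exists_east_step).2, fun c hc hc1 => ?_⟩
  obtain ⟨k, hk, hk01⟩ := exists_east_step_le_nat c hc hc1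
  exact (Nat.cast_le.2 (Nat.find_min' exists_east_step hk01)).trans hk

theorem isDccp_removeColumn (hP : IsDccp P) (hj1 : (1, (j : ℤ)) ∈ P)
    (hj_le : ∀ c ∈ P, 1 ≤ c.1 → (j : ℤ) ≤ c.2) : IsDccp (removeColumn j P) := by
  refine isDccp_iff.2 ⟨isDirected_of_west_mem_or_south_mem ?_ ?_ ?_, ?_⟩
  · exact mem_removeColumn.2 ⟨le_rfl, by simpa using hj1⟩
  · intro x y hc
    obtain ⟨hx, hc⟩ := mem_removeColumn.1 hc
    have := hj_le _ hc (by simpa using hx)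
    omega
  · intro x y hc
    simp only [mem_removeColumn] at hc ⊢
    obtain ⟨hx, hc⟩ := hc
    have hy := hj_le _ hc (by simpa using hx)
    rcases hP.isDirected.west_mem_or_south_mem hc with h_origin | h_west | h_south
    · omega
    · rcases hx.eq_or_lt with rfl | hx_pos
      · by_cases hy0 : y = 0
        · exact .inl ⟨rfl, hy0⟩
        · exact .inr (.inr ⟨le_rfl, hP.isColumnConvex _ _ _ _ hj1 hc (by omega) (by omega)⟩)
      · exact .inr (.inl ⟨by omega, add_sub_right_comm x 1 1 ▸ h_west⟩)
    · exact .inr (.inr ⟨hx, add_sub_right_comm y (j : ℤ) 1 ▸ h_south⟩)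
  · intro x y₁ y y₂ h₁ h₂ hy₁ hy₂
    rw [mem_removeColumn] at h₁ h₂ ⊢
    exact ⟨h₁.1, hP.isColumnConvex _ _ _ _ h₁.2 h₂.2 (by omega) (by omega)⟩

theorem IsDirected.glue_removeColumn (hP : IsDirected P)
    (hh : ∀ y : ℤ, (0, y) ∈ P ↔ 0 ≤ y ∧ y < h) (j : ℕ) :
    glue h j (removeColumn j P) = P := by
  ext ⟨x, y⟩
  rw [mem_glue, mem_removeColumn, sub_add_cancel, sub_add_cancel, ← hh]
  constructor
  · rintro (⟨rfl, hc⟩ | ⟨-, hc⟩) <;> exact hc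
  · intro hc
    rcases (hP.nonneg hc).1.eq_or_lt with rfl | hx
    · exact .inl ⟨rfl, hc⟩
    · exact .inr ⟨by omega, hc⟩

theorem IsDccp.eq_column_or_eq_glue (hP : IsDccp P) :
    P = column P.card ∨ ∃ h j Q, j < h ∧ IsDccp Q ∧ P = glue h j Q := by
  obtain ⟨h, hh⟩ := hP.exists_height
  by_cases hP1 : ∃ c ∈ P, 1 ≤ c.1
  · obtain ⟨j, hj0, hj1, hj_le⟩ := hP.isDirected.exists_altitude hP1
    exact .inr ⟨h, j, removeColumn j P, by exact_mod_cast ((hh j).1 hj0).2,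
      isDccp_removeColumn hP hj1 hj_le, (hP.isDirected.glue_removeColumn hh j).symm⟩
  · push Not at hP1
    have h_eq : P = column h := by
      ext ⟨x, y⟩
      rw [mem_column, ← hh]
      refine ⟨fun hc => ?_, fun ⟨hx, hc⟩ => hx ▸ hc⟩
      obtain rfl : x = 0 := by
        have := (hP.isDirected.nonneg hc).1
        have := hP1 _ hc
        omega
      exact ⟨rfl, hc⟩
    exact .inl (by rw [h_eq, card_column])

/-! ### Internal path lengths under gluing -/

theorem sum_range_add_one_eq_choose (h : ℕ) :
    ∑ k ∈ Finset.range h, (k + 1) = (h + 1).choose 2 := by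
  calc
    ∑ k ∈ Finset.range h, (k + 1) = ∑ k ∈ Finset.range (h + 1), k := by
      rw [Finset.sum_range_succ', add_zero]
    _ = (h + 1).choose 2 := by rw [Finset.sum_range_id, Nat.choose_two_right]

theorem IsDirected.sum_column_ipl (hP : IsDirected P) (h_sub : column h ⊆ P) :
    ∑ c ∈ column h, ipl P c = (h + 1).choose 2 := by
  rw [← sum_range_add_one_eq_choose, column, Finset.sum_product, Finset.sum_singleton,
    Finset.sum_map]
  refine Finset.sum_congr rfl fun k hk => ?_
  have h_mem : ((0 : ℤ), (k : ℤ)) ∈ P := h_sub (mem_column.2 (by simpa using hk))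
  have := hP.ipl_eq h_mem
  simp only [Nat.castEmbedding_apply]
  omega

theorem tipl_column (hh : 0 < h) : tipl (column h) = (h + 1).choose 2 :=
  (isDccp_column hh).isDirected.sum_column_ipl subset_rfl

theorem IsDirected.ipl_glue (hQ : IsDirected Q) (hj : j < h) {c : ℤ × ℤ} (hc : c ∈ Q) :
    ipl (glue h j Q) (c + (1, (j : ℤ))) = ipl Q c + (j + 1) := by
  have h_mem : c + (1, (j : ℤ)) ∈ glue h j Q :=
    Finset.mem_union_right _ (Finset.mem_map_of_mem _ hc)
  have h_glue := (isDirected_glue hQ hj).ipl_eq h_mem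
  have h_Q := hQ.ipl_eq hc
  simp only [Prod.fst_add, Prod.snd_add] at h_glue
  omega

theorem IsDirected.tipl_glue (hQ : IsDirected Q) (hj : j < h) :
    tipl (glue h j Q) = (h + 1).choose 2 + tipl Q + (j + 1) * Q.card := by
  have sum_right : ∑ c ∈ Q.map (addRightEmbedding ((1 : ℤ), (j : ℤ))),
      ipl (glue h j Q) c = tipl Q + (j + 1) * Q.card := by
    rw [Finset.sum_map, tipl, mul_comm, ← smul_eq_mul, ← Finset.sum_const,
      ← Finset.sum_add_distrib]
    exact Finset.sum_congr rfl fun c hc => hQ.ipl_glue hj hc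
  rw [add_assoc, ← sum_right, ← (isDirected_glue hQ hj).sum_column_ipl Finset.subset_union_left,
    ← Finset.sum_union (hQ.disjoint_column h j)]
  rfl

/-! ### Summation over polyominoes of given area -/

/-- The data `⟨(h, m), j, Q⟩` for which `glue h j Q` is a directed column-convex polyomino of area
`n` with at least two columns; `m` is the area of `Q`. -/
noncomputable def gluings (n : ℕ) : Finset ((_ : ℕ × ℕ) × ℕ × Finset (ℤ × ℤ)) :=
  (Finset.HasAntidiagonal.antidiagonal n).sigma fun p => Finset.range p.1 ×ˢ dccps p.2

theorem mem_gluings {n m : ℕ} :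
    (⟨(h, m), j, Q⟩ : (_ : ℕ × ℕ) × ℕ × Finset (ℤ × ℤ)) ∈ gluings n ↔
      h + m = n ∧ j < h ∧ IsDccp Q ∧ Q.card = m := by
  simp [gluings, mem_dccps]

theorem dccps_eq_insert {n : ℕ} (hn : 0 < n) :
    dccps n = insert (column n) ((gluings n).image fun s => glue s.1.1 s.2.1 s.2.2) := by
  ext P
  rw [Finset.mem_insert, Finset.mem_image, mem_dccps]
  constructor
  · rintro ⟨hP, rfl⟩
    refine hP.eq_column_or_eq_glue.imp_right ?_
    rintro ⟨h, j, Q, hj, hQ, rfl⟩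
    exact ⟨⟨(h, Q.card), j, Q⟩,
      mem_gluings.2 ⟨(hQ.isDirected.card_glue h j).symm, hj, hQ, rfl⟩, rfl⟩
  · rintro (rfl | ⟨⟨⟨h, m⟩, j, Q⟩, hs, rfl⟩)
    · exact ⟨isDccp_column hn, card_column n⟩
    · obtain ⟨rfl, hj, hQ, rfl⟩ := mem_gluings.1 hs
      exact ⟨isDccp_glue hQ hj, hQ.isDirected.card_glue h j⟩

theorem sum_dccps {M : Type*} [AddCommMonoid M] {n : ℕ} (hn : 0 < n)
    (f : Finset (ℤ × ℤ) → M) :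
    ∑ P ∈ dccps n, f P = f (column n) +
      ∑ p ∈ Finset.HasAntidiagonal.antidiagonal n,
        ∑ j ∈ Finset.range p.1, ∑ Q ∈ dccps p.2, f (glue p.1 j Q) := by
  rw [dccps_eq_insert hn, Finset.sum_insert, Finset.sum_image, gluings, Finset.sum_sigma]
  · simp only [Finset.sum_product]
  · rintro ⟨⟨h, m⟩, j, Q⟩ hs ⟨⟨h', m'⟩, j', Q'⟩ hs' h_eq
    obtain ⟨-, -, hQ, rfl⟩ := mem_gluings.1 hs
    obtain ⟨-, -, hQ', rfl⟩ := mem_gluings.1 hs'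
    obtain ⟨rfl, rfl, rfl⟩ := glue_inj hQ.isDirected hQ'.isDirected h_eq
    rfl
  · rw [Finset.mem_image]
    rintro ⟨⟨⟨h, m⟩, j, Q⟩, hs, h_eq⟩
    exact glue_ne_column (mem_gluings.1 hs).2.2.1.isDirected h j n h_eq

end Geometry

/-! ### Generating functions -/

section Series

open PowerSeries

variable {R : Type*}

/-- The generating function, by area, of the statistic `f` on directed column-convex
polyominoes. -/
noncomputable def areaSeries [Semiring R] (f : Finset (ℤ × ℤ) → R) : R⟦X⟧ :=
  mk fun n => ∑ P ∈ dccps n, f P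

theorem areaSeries_eq_of_glue [CommSemiring R] {ι : Type*} [Fintype ι] {f : Finset (ℤ × ℤ) → R}
    (u : ι → ℕ → ℕ → R) (g : ι → Finset (ℤ × ℤ) → R)
    (hf : ∀ h j Q, j < h → IsDccp Q → f (glue h j Q) = ∑ i, u i h j * g i Q) :
    areaSeries f = X * ((mk fun h => f (column (h + 1))) +
      ∑ i, (mk fun h => ∑ j ∈ Finset.range (h + 1), u i (h + 1) j) * areaSeries (g i)) := by
  have sum_glue (h m : ℕ) : ∑ j ∈ Finset.range h, ∑ Q ∈ dccps m, f (glue h j Q) =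
      ∑ i, (∑ j ∈ Finset.range h, u i h j) * ∑ Q ∈ dccps m, g i Q := by
    simp only [Finset.sum_mul_sum]
    rw [← Finset.sum_comm_cycle]
    exact Finset.sum_congr rfl fun j hj => Finset.sum_congr rfl fun Q hQ =>
      hf h j Q (Finset.mem_range.1 hj) (mem_dccps.1 hQ).1
  ext n
  cases n with
  | zero => simp [areaSeries, dccps_zero]
  | succ n =>
    rw [coeff_succ_X_mul, areaSeries, coeff_mk, sum_dccps n.succ_pos,
      Finset.Nat.sum_antidiagonal_succ, Finset.range_zero, Finset.sum_empty, zero_add, map_add,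
      coeff_mk, map_sum]
    simp only [sum_glue, coeff_mul, areaSeries, coeff_mk]
    rw [Finset.sum_comm]

theorem X_mul_derivative_areaSeries [CommSemiring R] (f : Finset (ℤ × ℤ) → R) :
    X * d⁄dX R (areaSeries f) = areaSeries fun P => (P.card : R) * f P := by
  ext n
  have sum_card_mul : ∑ P ∈ dccps n, (P.card : R) * f P = n * ∑ P ∈ dccps n, f P := by
    rw [Finset.mul_sum]
    exact Finset.sum_congr rfl fun P hP => by rw [(mem_dccps.1 hP).2]
  rw [areaSeries, areaSeries, coeff_mk, sum_card_mul]
  cases n with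
  | zero => simp
  | succ n =>
    rw [coeff_succ_X_mul, coeff_derivative, coeff_mk, mul_comm, Nat.cast_succ]

section CommRing

variable [CommRing R]

theorem mk_one_sq : (mk 1 : R⟦X⟧) ^ 2 = mk fun n => (n : R) + 1 := by
  rw [mk_one_pow_eq_mk_choose_add]
  ext n
  simp [add_comm]

theorem mk_one_pow_three : (mk 1 : R⟦X⟧) ^ 3 = mk fun n => ((n + 2).choose 2 : R) := by
  rw [mk_one_pow_eq_mk_choose_add]
  ext n
  rw [coeff_mk, coeff_mk, add_comm]

theorem mk_add_one_mul_choose_two :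
    (mk fun n => ((n : R) + 1) * ((n + 2).choose 2 : R)) =
      3 * (mk 1 : R⟦X⟧) ^ 4 - 2 * (mk 1 : R⟦X⟧) ^ 3 := by
  rw [mk_one_pow_three, mk_one_pow_eq_mk_choose_add]
  ext n
  have absorption := congrArg (Nat.cast (R := R)) (Nat.add_one_mul_choose_eq (n + 2) 2)
  push_cast at absorption
  rw [map_sub, ← map_ofNat C 3, ← map_ofNat C 2, coeff_C_mul, coeff_C_mul, coeff_mk, coeff_mk,
    coeff_mk, add_comm 3 n]
  linear_combination absorption

theorem areaSeries_one_eq :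
    areaSeries (fun _ => (1 : R)) =
      X * (mk 1 + (mk 1 : R⟦X⟧) ^ 2 * areaSeries fun _ => (1 : R)) := by
  rw [mk_one_sq]
  simpa [Pi.one_def] using areaSeries_eq_of_glue (ι := Unit) (f := fun _ => (1 : R))
    (fun _ _ _ => 1) (fun _ _ => 1) (by simp)

theorem areaSeries_tipl_eq :
    areaSeries (fun P => (tipl P : R)) = X * ((mk 1 : R⟦X⟧) ^ 3 +
      ((3 * (mk 1 : R⟦X⟧) ^ 4 - 2 * (mk 1 : R⟦X⟧) ^ 3) * areaSeries (fun _ => (1 : R)) +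
        (mk 1 : R⟦X⟧) ^ 2 * areaSeries (fun P => (tipl P : R)) +
        (mk 1 : R⟦X⟧) ^ 3 * (X * d⁄dX R (areaSeries fun _ => (1 : R))))) := by
  have sum_add_one (h : ℕ) : ∑ j ∈ Finset.range (h + 1), ((j : R) + 1) = (h + 2).choose 2 := by
    exact_mod_cast congrArg (Nat.cast (R := R)) (sum_range_add_one_eq_choose (h + 1))
  have h_glue := areaSeries_eq_of_glue (f := fun P => (tipl P : R))
    ![fun h _ => ((h + 1).choose 2 : R), fun _ _ => 1, fun _ j => (j : R) + 1]
    ![fun _ => 1, fun Q => (tipl Q : R), fun Q => (Q.card : R)]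
    (fun h j Q hj hQ => by simp [hQ.isDirected.tipl_glue hj, Fin.sum_univ_three])
  rw [← mk_add_one_mul_choose_two, X_mul_derivative_areaSeries, mk_one_sq, mk_one_pow_three]
  simpa [Fin.sum_univ_three, tipl_column, sum_add_one] using h_glue

theorem areaSeries_one_mul :
    areaSeries (fun _ => (1 : R)) * (X ^ 2 - 3 * X + 1) = X * (1 - X) := by
  have h_geom := mk_one_mul_one_sub_eq_one R
  have h_eq := areaSeries_one_eq (R := R)
  generalize areaSeries (fun _ => (1 : R)) = F at *
  generalize (mk 1 : R⟦X⟧) = G at *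
  linear_combination (1 - X) ^ 2 * h_eq + X * (1 - X) * h_geom +
    X * F * (G * (1 - X) + 1) * h_geom

theorem derivative_areaSeries_one_mul :
    d⁄dX R (areaSeries fun _ => (1 : R)) * (X ^ 2 - 3 * X + 1) ^ 2 = 1 - 2 * X + 2 * X ^ 2 := by
  have h_deriv := congrArg (d⁄dX R) (areaSeries_one_mul (R := R))
  have derivative_three : d⁄dX R (3 : R⟦X⟧) = 0 := (d⁄dX R).map_natCast 3
  simp only [Derivation.leibniz, Derivation.leibniz_pow, map_add, map_sub, derivative_X,
    derivative_three, Derivation.map_one_eq_zero, smul_eq_mul, nsmul_eq_mul] at h_deriv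
  push_cast at h_deriv
  linear_combination (X ^ 2 - 3 * X + 1) * h_deriv + (3 - 2 * X) * areaSeries_one_mul (R := R)

theorem areaSeries_tipl_mul :
    areaSeries (fun P => (tipl P : R)) * ((1 - X) * (X ^ 2 - 3 * X + 1) ^ 3) =
      X * (3 * X ^ 4 - 9 * X ^ 3 + 8 * X ^ 2 - 4 * X + 1) := by
  have h_geom := mk_one_mul_one_sub_eq_one R
  have h_eq := areaSeries_tipl_eq (R := R)
  have h_one := areaSeries_one_mul (R := R)
  have h_deriv := derivative_areaSeries_one_mul (R := R)
  generalize d⁄dX R (areaSeries fun _ => (1 : R)) = F' at *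
  generalize areaSeries (fun _ => (1 : R)) = F at *
  generalize areaSeries (fun P => (tipl P : R)) = T at *
  generalize (mk 1 : R⟦X⟧) = G at *
  have geom_pow (k : ℕ) : G ^ k * (1 - X) ^ k = 1 := by rw [← mul_pow, h_geom, one_pow]
  have cleared : T * (X ^ 2 - 3 * X + 1) * (1 - X) ^ 2 =
      X * ((1 - X) + (1 + 2 * X) * F + (1 - X) * (X * F')) := by
    linear_combination (1 - X) ^ 4 * h_eq + X * (1 - X) * (1 - 2 * F + X * F') * geom_pow 3 +
      3 * X * F * geom_pow 4 + X * (1 - X) ^ 2 * T * geom_pow 2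
  have one_sub_X_mul : (1 - X) * (T * ((1 - X) * (X ^ 2 - 3 * X + 1) ^ 3)) =
      (1 - X) * (X * (3 * X ^ 4 - 9 * X ^ 3 + 8 * X ^ 2 - 4 * X + 1)) := by
    linear_combination (X ^ 2 - 3 * X + 1) ^ 2 * cleared +
      X * (1 + 2 * X) * (X ^ 2 - 3 * X + 1) * h_one + X ^ 2 * (1 - X) * h_deriv
  exact (IsUnit.of_mul_eq_one_right G h_geom).mul_left_cancel one_sub_X_mul

end CommRing

theorem dccpTiplSeries_eq_areaSeries :
    dccpTiplSeries = areaSeries fun P => (tipl P : ℚ) := by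
  simp only [dccpTiplSeries, areaSeries, Nat.cast_sum]

theorem dccpTiplSeries_eq_restrictedTiplSeries_zero :
    dccpTiplSeries = restrictedTiplSeries 0 := by
  classical
  ext n
  rw [dccpTiplSeries, restrictedTiplSeries, coeff_mk, coeff_mk, restrictedTipl,
    Finset.filter_true_of_mem]
  exact fun P hP => (mem_dccps.1 hP).1.isDirected.isRestricted_zero

end Series

end Polyomino

theorem mainTheorem6 :
    Polyomino.dccpTiplSeries = Polyomino.restrictedTiplSeries 0 ∧
      Polyomino.restrictedTiplSeries 0 =
        (PowerSeries.X * (3 * PowerSeries.X ^ 4 - 9 * PowerSeries.X ^ 3 + 8 * PowerSeries.X ^ 2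
            - 4 * PowerSeries.X + 1)) *
          ((1 - PowerSeries.X) *
            (PowerSeries.X ^ 2 - 3 * PowerSeries.X + 1) ^ 3 : PowerSeries ℚ)⁻¹ := by
  refine ⟨Polyomino.dccpTiplSeries_eq_restrictedTiplSeries_zero, ?_⟩
  rw [← Polyomino.dccpTiplSeries_eq_restrictedTiplSeries_zero,
    Polyomino.dccpTiplSeries_eq_areaSeries, PowerSeries.eq_mul_inv_iff_mul_eq (by simp)]
  exact Polyomino.areaSeries_tipl_mul
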